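/- A three-user finite-field multi-way relay channel (MWRC) with correlated sources is given by the following. There are three users $1,2,3$ and a relay $0$. The source triplets $(W_1[u],W_2[u],W_3[u])$, $u=1,\dots,m$, are i.i.d. with an arbitrary joint probability mass function $p(w_1,w_2,w_3)$ on discrete alphabets; user $i$ has the message $\mathbf W_i=(W_i[1],\dots,W_i[m])$. All channel inputs $X_d$, outputs $Y_d$ and noises $N_d$ ($d\in\{0,1,2,3\}$) take values in a finite field $\mathcal F$ with $|\mathcal F|=F$, and each channel use is $$Y_0=X_1\oplus X_2\oplus X_3\oplus N_0,\qquad Y_i=X_0\oplus N_i\quad (i=1,2,3).$$ The noises of all nodes and all channel uses are mutually independent and independent of the sources, the distribution of $N_d$ does not change over time, and $N_d$ is not uniformly distributed, i.e. $H(N_d)<\log F$, for each $d\in\{0,1,2,3\}$. A block code of source-channel rate $\kappa=n/m$ (with $m\ge 1$ source triplets and $n$ channel uses) consists of encoding functions, $X_i[t]=f_{i,t}(\mathbf W_i,Y_i[1],\dots,Y_i[t-1])$ for the users and $X_0[t]=f_{0,t}(Y_0[1],\dots,Y_0[t-1])$ for the relay, $t=1,\dots,n$ (so feedback is permitted), and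 decoding functions, by which user $i$ estimates the messages of the other two users from $(Y_i[1],\dots,Y_i[n])$ and $\mathbf W_i$. Let $P_{\mathrm e}$ be the probability that at least one user estimates the messages of the other two incorrectly. The rate $\kappa$ is achievable if for every $\zeta>0$ there is a block code of source-channel rate $\kappa$ with $P_{\mathrm e}<\zeta$. Let $\kappa^*$ be the infimum of the achievable rates ($+\infty$ if there are none). Then, for any such MWRC, $$\kappa^*\ \ge\ \Phi:=\max_{i,j,k\in\{1,2,3\}\text{ distinct}}\ \frac{H(W_j,W_k\mid W_i)}{\log F-\max\{H(N_0),H(N_i)\}},$$ where entropies and $\log F$ are taken with the same logarithm base, and the right-hand side is $+\infty$ if one of the conditional entropies is infinite. -/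

import Mathlib

open scoped NNReal ENNReal

noncomputable section

namespace MWRC

/-- Shannon entropy (in nats) of a distribution on a finite alphabet. -/
def entropy {α : Type*} [Fintype α] (q : PMF α) : ℝ :=
  ∑ a, Real.negMulLog (q a).toReal

/-- Conditional Shannon entropy (in nats) `H(X|Y)` of two discrete random variables `X`, `Y` on a
probability space with discrete law `p`:
`H(X|Y) = ∑ P(X = x, Y = y) * log (P(Y = y) / P(X = x, Y = y))`.
All terms are nonnegative, and the value is `∞` exactly when the series diverges. -/
def condEntropy {Ω α β : Type*} (p : PMF Ω) (X : Ω → α) (Y : Ω → β) : ℝ≥0∞ :=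
  ∑' a : α × β, ENNReal.ofReal
    ((p.map (fun ω => (X ω, Y ω)) a).toReal *
      Real.log ((p.map Y a.2).toReal / (p.map (fun ω => (X ω, Y ω)) a).toReal))

/-- A block code with `m` source symbols per user and `n` channel uses. The three users are indexed
by `Fin 3`, user `i` having source alphabet `W i`; the channel alphabet is `K`.
The symbol sent by a node in channel use `t` may depend on the node's message (the relay has none)
and on all the channel outputs that the node received in the channel uses before `t`. -/
structure BlockCode (W : Fin 3 → Type*) (K : Type*) (m n : ℕ) where
  /-- Encoding functions of the users. -/
  userEnc : (i : Fin 3) → (t : Fin n) → (Fin m → W i) → (Fin t.val → K) → K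
  /-- Encoding functions of the relay. -/
  relayEnc : (t : Fin n) → (Fin t.val → K) → K
  /-- User `i` estimates the messages of the two other users from its received channel symbols and
  its own message. -/
  dec : (i : Fin 3) → (Fin n → K) → (Fin m → W i) → ((j : {j : Fin 3 // j ≠ i}) → Fin m → W j)

variable {W : Fin 3 → Type*} {K : Type*} {m n : ℕ}

/-- The channel outputs in channel use `t`, at the relay (first component) and at the three users
(second component), when the source triplets are `w` and the noise symbols are `z₀` at the relay
and `z i` at user `i`: `Y₀ = X₁ + X₂ + X₃ + N₀` and `Yᵢ = X₀ + Nᵢ`. -/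
def received [Field K] (c : BlockCode W K m n) (w : Fin m → (i : Fin 3) → W i)
    (z₀ : Fin n → K) (z : Fin 3 → Fin n → K) (t : Fin n) : K × (Fin 3 → K) :=
  ((∑ i, c.userEnc i t (fun u => w u i)
      (fun s => (received c w z₀ z ⟨s.val, s.isLt.trans t.isLt⟩).2 i)) + z₀ t,
    fun i => c.relayEnc t
      (fun s => (received c w z₀ z ⟨s.val, s.isLt.trans t.isLt⟩).1) + z i t)
  termination_by t.val

/-- At least one user estimates the messages of the other two users incorrectly. -/
def DecodingError [Field K] (c : BlockCode W K m n) (w : Fin m → (i : Fin 3) → W i)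
    (z₀ : Fin n → K) (z : Fin 3 → Fin n → K) : Prop :=
  ∃ i : Fin 3,
    c.dec i (fun t => (received c w z₀ z t).2 i) (fun u => w u i) ≠ fun (j : {j : Fin 3 // j ≠ i}) u => w u j

open Classical in
/-- The probability `Pₑ` that one or more users make a decoding error, when the source triplets are
i.i.d. with law `p`, the noise symbols are i.i.d. over time with law `q₀` at the relay and `q i` at
user `i`, and source triplets and noise symbols of all nodes are mutually independent. -/
def errorProb [Field K] [Fintype K] (p : PMF ((i : Fin 3) → W i)) (q₀ : PMF K)
    (q : Fin 3 → PMF K) (c : BlockCode W K m n) : ℝ≥0∞ :=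
  ∑' w : Fin m → (i : Fin 3) → W i, ∑ z₀ : Fin n → K, ∑ z : Fin 3 → Fin n → K,
    if DecodingError c w z₀ z then
      (∏ u, p (w u)) * (∏ t, q₀ (z₀ t)) * ∏ i, ∏ t, q i (z i t)
    else 0

/-- The source-channel rate `κ` (channel uses per source triplet) is achievable: block codes of
rate `n / m = κ` with arbitrarily small error probability exist. -/
def Achievable [Field K] [Fintype K] (p : PMF ((i : Fin 3) → W i)) (q₀ : PMF K)
    (q : Fin 3 → PMF K) (κ : ℝ≥0) : Prop :=
  ∀ ζ : ℝ≥0∞, 0 < ζ → ∃ m n : ℕ, 0 < m ∧ (n : ℝ≥0) / (m : ℝ≥0) = κ ∧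
    ∃ c : BlockCode W K m n, errorProb p q₀ q c < ζ

/-- The minimum source-channel rate `κ*`: the infimum of the achievable rates (`∞` if there are
none). -/
def minRate [Field K] [Fintype K] (p : PMF ((i : Fin 3) → W i)) (q₀ : PMF K)
    (q : Fin 3 → PMF K) : ℝ≥0∞ :=
  ⨅ (κ : ℝ≥0) (_ : Achievable p q₀ q κ), (κ : ℝ≥0∞)

/-- `Φ`, the maximum over distinct users `i`, `j`, `k` of
`H(W_j, W_k | W_i) / (log |K| - max {H(N₀), H(N_i)})`. -/
def Phi [Fintype K] (p : PMF ((i : Fin 3) → W i)) (q₀ : PMF K) (q : Fin 3 → PMF K) : ℝ≥0∞ :=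
  ⨆ (i : Fin 3) (j : Fin 3) (k : Fin 3) (_ : i ≠ j ∧ j ≠ k ∧ i ≠ k),
    condEntropy p (fun w => (w j, w k)) (fun w => w i) /
      ENNReal.ofReal (Real.log (Fintype.card K) - max (entropy q₀) (entropy (q i)))

end MWRC

end

/-! The converse is a change of measure, which handles feedback and infinite alphabets together. Fix
a user `i` and a code, and let `P` be the joint law of sources and noises. When all users decode
correctly, `W_i`, `Y₀` and the user noises determine the outcome: they give every user's output,
decoding gives the sources, and subtraction gives `N₀` (`injOn_relayOutput`). The same holds for
`W_i`, `N₀`, `Y_i` and the noises of the other users (`injOn_userOutput`).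

Hence, if the source law is replaced by the marginal of `W_i` and the law of the recovered noise by
a uniform law at the corresponding output, the resulting `Q` has mass at most one on the success
event. The inequality `log x ≤ x - 1` at `x = Q / P`, summed over that event, bounds the source
information given `W_i` by `n (log F - H(N))` plus an error term (`mul_tsum_min_condInfo_le`).

The information density may be unbounded, so it is truncated at `b`; failure then costs at most `Pₑ
m b`. Dividing by `m`, letting `Pₑ → 0` and then `b → ∞` gives the bound for each noise
(`tsum_mul_condInfo_le`). -/

namespace MWRC

/-- The joint probability of `m` i.i.d. source symbols and of the noise symbols of all nodes. -/
noncomputable def weight {α K : Type*} {m n : ℕ} (p : PMF α) (q₀ : PMF K) (q : Fin 3 → PMF K)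
    (x : (Fin m → α) × (Fin n → K) × (Fin 3 → Fin n → K)) : ℝ≥0∞ :=
  (∏ u, p (x.1 u)) * (∏ t, q₀ (x.2.1 t)) * ∏ i, ∏ t, q i (x.2.2 i t)

/-- The information density `log (P(f ω) / P(ω))` of `ω` given the value `f ω`. -/
noncomputable def condInfo {Ω β : Type*} (p : PMF Ω) (f : Ω → β) (ω : Ω) : ℝ≥0∞ :=
  ENNReal.ofReal (Real.log ((p.map f (f ω)).toReal / (p ω).toReal))

/-! ### Product laws and their marginals -/

theorem tsum_pi_prod {α : Type*} : ∀ {n : ℕ} (f : Fin n → α → ℝ≥0∞),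
    ∑' w : Fin n → α, ∏ u, f u (w u) = ∏ u, ∑' a, f u a
  | 0, f => by simp
  | n + 1, f => by
    rw [← (Fin.consEquiv (fun _ => α)).tsum_eq, ENNReal.tsum_prod', Fin.prod_univ_succ,
      ← tsum_pi_prod fun u => f u.succ]
    simp [Fin.consEquiv, Fin.prod_univ_succ, ENNReal.tsum_mul_left, ENNReal.tsum_mul_right]

theorem tsum_pi_prod_mul_apply {α : Type*} {n : ℕ} (f : Fin n → α → ℝ≥0∞)
    (hf : ∀ u, ∑' a, f u a = 1) (g : α → ℝ≥0∞) (v : Fin n) :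
    ∑' w : Fin n → α, (∏ u, f u (w u)) * g (w v) = ∑' a, f v a * g a := by
  -- Absorb `g` into the factor at `v`; all other factors sum to one.
  have h := tsum_pi_prod (Function.update f v fun a => f v a * g a)
  rw [Fintype.prod_eq_single v] at h
  · rw [Function.update_self] at h
    rw [← h]
    refine tsum_congr fun w => ?_
    have he : ∀ u ∈ Finset.univ.erase v,
        Function.update f v (fun a => f v a * g a) u (w u) = f u (w u) := fun u hu => by
      rw [Function.update_of_ne (Finset.ne_of_mem_erase hu)]
    rw [← Finset.mul_prod_erase _ _ (Finset.mem_univ v),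
      ← Finset.mul_prod_erase Finset.univ
        (fun u => Function.update f v (fun a => f v a * g a) u (w u))
        (Finset.mem_univ v), Function.update_self, Finset.prod_congr rfl he]
    ring
  · intro u hu
    rw [Function.update_of_ne hu, hf]

section weight

variable {α K : Type*} {m n : ℕ} (p : PMF α) (q₀ : PMF K) (q : Fin 3 → PMF K)

theorem tsum_prod_pmf {n : ℕ} (r : PMF α) : ∑' w : Fin n → α, ∏ u, r (w u) = 1 := by
  rw [tsum_pi_prod fun _ => r]
  simp [PMF.tsum_coe]

theorem tsum_weight_mul (f : (Fin m → α) → ℝ≥0∞) (g₀ : (Fin n → K) → ℝ≥0∞)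
    (g : (Fin 3 → Fin n → K) → ℝ≥0∞) :
    ∑' x, weight p q₀ q x * (f x.1 * g₀ x.2.1 * g x.2.2) =
      (∑' w, (∏ u, p (w u)) * f w) * (∑' z₀, (∏ t, q₀ (z₀ t)) * g₀ z₀) *
        ∑' z, (∏ i, ∏ t, q i (z i t)) * g z := by
  rw [ENNReal.tsum_prod', mul_assoc, ← ENNReal.tsum_mul_right]
  refine tsum_congr fun w => ?_
  rw [ENNReal.tsum_prod', ← ENNReal.tsum_mul_right, ← ENNReal.tsum_mul_left]
  refine tsum_congr fun z₀ => ?_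
  rw [← ENNReal.tsum_mul_left, ← ENNReal.tsum_mul_left]
  refine tsum_congr fun z => ?_
  simp only [weight]
  ring

theorem tsum_prod_prod_pmf : ∑' z : Fin 3 → Fin n → K, ∏ i, ∏ t, q i (z i t) = 1 := by
  rw [tsum_pi_prod fun i (x : Fin n → K) => ∏ t, q i (x t)]
  simp [tsum_prod_pmf]

theorem tsum_weight : ∑' x, weight (m := m) (n := n) p q₀ q x = 1 := by
  have h := tsum_weight_mul (m := m) (n := n) p q₀ q (fun _ => 1) (fun _ => 1) (fun _ => 1)
  simpa [tsum_prod_pmf, tsum_prod_prod_pmf] using h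

theorem tsum_weight_mul_source (f : α → ℝ≥0∞) (u : Fin m) :
    ∑' x, weight (n := n) p q₀ q x * f (x.1 u) = ∑' a, p a * f a := by
  have h := tsum_weight_mul (m := m) (n := n) p q₀ q (fun w => f (w u)) (fun _ => 1) (fun _ => 1)
  simpa [tsum_prod_pmf, tsum_prod_prod_pmf,
    tsum_pi_prod_mul_apply (fun _ => p) (fun _ => p.tsum_coe)] using h

theorem tsum_weight_mul_relayNoise (f : K → ℝ≥0∞) (t : Fin n) :
    ∑' x, weight (m := m) p q₀ q x * f (x.2.1 t) = ∑' a, q₀ a * f a := by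
  have h := tsum_weight_mul (m := m) (n := n) p q₀ q (fun _ => 1) (fun z => f (z t)) (fun _ => 1)
  simpa [tsum_prod_pmf, tsum_prod_prod_pmf,
    tsum_pi_prod_mul_apply (fun _ => q₀) (fun _ => q₀.tsum_coe)] using h

theorem tsum_weight_mul_userNoise (f : K → ℝ≥0∞) (i : Fin 3) (t : Fin n) :
    ∑' x, weight (m := m) p q₀ q x * f (x.2.2 i t) = ∑' a, q i a * f a := by
  have h := tsum_weight_mul (m := m) (n := n) p q₀ q (fun _ => 1) (fun _ => 1)
    (fun z => f (z i t))
  have h' := tsum_pi_prod_mul_apply (fun j (x : Fin n → K) => ∏ t, q j (x t))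
    (fun j => tsum_prod_pmf (q j)) (fun x => f (x t)) i
  rw [h', tsum_pi_prod_mul_apply (fun _ => q i) (fun _ => (q i).tsum_coe)] at h
  simpa [tsum_prod_pmf] using h

end weight

/-! ### Entropy as an expected log-density -/

section entropy

theorem le_map_apply {Ω β : Type*} (p : PMF Ω) (f : Ω → β) (ω : Ω) : p ω ≤ p.map f (f ω) := by
  classical
  rw [PMF.map_apply]
  refine le_trans ?_ (ENNReal.le_tsum ω)
  simp

theorem map_apply_of_injective {Ω β : Type*} (p : PMF Ω) {f : Ω → β}
    (hf : Function.Injective f) (ω : Ω) : p.map f (f ω) = p ω := by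
  classical
  rw [PMF.map_apply, tsum_eq_single ω]
  · simp
  · intro ω' h
    rw [if_neg fun h' => h (hf h').symm]

theorem condEntropy_of_injective {Ω α β : Type*} (p : PMF Ω) (X : Ω → α) (Y : Ω → β)
    (h : Function.Injective fun ω => (X ω, Y ω)) :
    condEntropy p X Y = ∑' ω, p ω * condInfo p Y ω := by
  unfold condEntropy
  -- Pairs outside the range of `ω ↦ (X ω, Y ω)` have probability zero and contribute nothing.
  rw [← h.tsum_eq]
  · refine tsum_congr fun ω => ?_
    rw [map_apply_of_injective p h, ENNReal.ofReal_mul ENNReal.toReal_nonneg,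
      ENNReal.ofReal_toReal (p.apply_ne_top ω)]
    rfl
  · intro a ha
    have : a ∈ (p.map fun ω => (X ω, Y ω)).support := by
      rw [PMF.mem_support_iff]
      intro h0
      exact ha (by simp only [h0, ENNReal.toReal_zero, zero_mul, ENNReal.ofReal_zero])
    obtain ⟨ω, -, rfl⟩ := (PMF.mem_support_map_iff _ _ _).1 this
    exact ⟨ω, rfl⟩

/-- A bound on the absolute value of the logarithm of the density of `r` with respect to the
uniform distribution. -/
noncomputable def logDensityBound {K : Type*} [Fintype K] (r : PMF K) : ℝ :=
  ∑ k, |Real.log (Fintype.card K * (r k).toReal)|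

theorem logDensityBound_nonneg {K : Type*} [Fintype K] (r : PMF K) : 0 ≤ logDensityBound r :=
  Finset.sum_nonneg fun _ _ => abs_nonneg _

theorem log_add_logDensityBound_nonneg {K : Type*} [Fintype K] (r : PMF K) (k : K) :
    0 ≤ Real.log (Fintype.card K * (r k).toReal) + logDensityBound r := by
  have h : |Real.log (Fintype.card K * (r k).toReal)| ≤ logDensityBound r :=
    Finset.single_le_sum (f := fun k => |Real.log (Fintype.card K * (r k).toReal)|)
      (fun _ _ => abs_nonneg _) (Finset.mem_univ k)
  linarith [neg_abs_le (Real.log (Fintype.card K * (r k).toReal))]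

/-- The log-density of `r` with respect to the uniform distribution, shifted to be nonnegative. -/
noncomputable def shiftedLogDensity {K : Type*} [Fintype K] (r : PMF K) (k : K) : ℝ≥0∞ :=
  ENNReal.ofReal (Real.log (Fintype.card K * (r k).toReal) + logDensityBound r)

theorem sum_toReal_pmf {K : Type*} [Fintype K] (r : PMF K) : ∑ k, (r k).toReal = 1 := by
  rw [← ENNReal.toReal_sum fun k _ => r.apply_ne_top k, ← tsum_fintype (L := .unconditional _),
    r.tsum_coe, ENNReal.toReal_one]

/-- The mean log-density relative to the uniform law is `log |K| - H(r)`; the shift keeps every term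
in `ℝ≥0∞`. -/
theorem tsum_mul_shiftedLogDensity {K : Type*} [Fintype K] (r : PMF K) :
    ∑' k, r k * shiftedLogDensity r k =
      ENNReal.ofReal (Real.log (Fintype.card K) - entropy r + logDensityBound r) := by
  have hK : Nonempty K := r.support_nonempty.to_type
  have hK' : (Fintype.card K : ℝ) ≠ 0 := by simp
  have hterm : ∀ k, r k * shiftedLogDensity r k = ENNReal.ofReal
      ((r k).toReal * (Real.log (Fintype.card K * (r k).toReal) + logDensityBound r)) := by
    intro k
    rw [ENNReal.ofReal_mul ENNReal.toReal_nonneg, ENNReal.ofReal_toReal (r.apply_ne_top k)]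
    rfl
  simp only [hterm]
  rw [tsum_fintype, ← ENNReal.ofReal_sum_of_nonneg fun k _ =>
    mul_nonneg ENNReal.toReal_nonneg (log_add_logDensityBound_nonneg r k)]
  congr 1
  have hlog : ∀ k, (r k).toReal * (Real.log (Fintype.card K * (r k).toReal) + logDensityBound r) =
      (r k).toReal * (Real.log (Fintype.card K) + logDensityBound r) -
        Real.negMulLog (r k).toReal := by
    intro k
    rcases eq_or_ne (r k).toReal 0 with h | h
    · simp [h]
    · rw [Real.log_mul hK' h, Real.negMulLog]
      ring
  simp only [hlog]
  rw [Finset.sum_sub_distrib, ← Finset.sum_mul, sum_toReal_pmf, entropy]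
  ring

end entropy

/-! ### Change of measure on an event -/

section changeOfMeasure

/-- This is `log x ≤ x - 1` multiplied by `P = ∏ a * ∏ r`, where `x = Q / P` and `Q = ∏ b * ∏ F⁻¹`.
-/
theorem prod_mul_sum_log_le {ι τ : Type*} [Fintype ι] [Fintype τ] (a b : ι → ℝ) (r : τ → ℝ)
    (F : ℝ) (ha : ∀ u, 0 < a u) (hb : ∀ u, 0 < b u) (hr : ∀ t, 0 < r t) (hF : 0 < F) :
    (∏ u, a u) * (∏ t, r t) * (∑ u, Real.log (b u / a u) + 1) ≤
      (∏ u, b u) * (∏ _t : τ, F⁻¹) + (∏ u, a u) * (∏ t, r t) * ∑ t, Real.log (F * r t) := by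
  have hA : 0 < ∏ u, a u := Finset.prod_pos fun u _ => ha u
  have hB : 0 < ∏ u, b u := Finset.prod_pos fun u _ => hb u
  have hR : 0 < ∏ t, r t := Finset.prod_pos fun t _ => hr t
  have hFp : 0 < ∏ _t : τ, F := Finset.prod_pos fun t _ => hF
  have hx := Real.log_le_sub_one_of_pos
    (div_pos (div_pos hB hA) (mul_pos hFp hR))
  rw [Real.log_div (div_pos hB hA).ne' (mul_pos hFp hR).ne', ← Finset.prod_div_distrib,
    ← Finset.prod_mul_distrib, Real.log_prod fun u _ => (div_pos (hb u) (ha u)).ne',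
    Real.log_prod fun t _ => (mul_pos hF (hr t)).ne', Finset.prod_div_distrib,
    Finset.prod_mul_distrib] at hx
  have h := mul_le_mul_of_nonneg_left hx (mul_pos hA hR).le
  have he : (∏ u, a u) * (∏ t, r t) * ((∏ u, b u) / (∏ u, a u) / ((∏ _t : τ, F) * ∏ t, r t) - 1) =
      (∏ u, b u) * (∏ _t : τ, F⁻¹) - (∏ u, a u) * (∏ t, r t) := by
    rw [Finset.prod_inv_distrib]
    field_simp
  rw [he] at h
  linarith

/-- Adding `n * logDensityBound r` to both sides makes the possibly negative `log (|K| r)`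
nonnegative, so `prod_mul_sum_log_le` carries over to `ℝ≥0∞`. -/
theorem prod_mul_condInfo_le {Ω β K : Type*} [Fintype K] {m n : ℕ} (p : PMF Ω) (f : Ω → β)
    (r : PMF K) (w : Fin m → Ω) (z : Fin n → K) :
    (∏ u, p (w u)) * (∏ t, r (z t)) *
        (∑ u, condInfo p f (w u) + 1 + n * ENNReal.ofReal (logDensityBound r)) ≤
      (∏ u, p.map f (f (w u))) * (∏ _t : Fin n, (Fintype.card K : ℝ≥0∞)⁻¹) +
        (∏ u, p (w u)) * (∏ t, r (z t)) * ∑ t, shiftedLogDensity r (z t) := by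
  by_cases h0 : (∏ u, p (w u)) * (∏ t, r (z t)) = 0
  · simp [h0]
  have hp : ∀ u, p (w u) ≠ 0 := by
    intro u hu
    exact h0 (by rw [Finset.prod_eq_zero (Finset.mem_univ u) hu, zero_mul])
  have hr : ∀ t, r (z t) ≠ 0 := by
    intro t ht
    exact h0 (by rw [Finset.prod_eq_zero (Finset.mem_univ t) ht, mul_zero])
  have hK : Nonempty K := r.support_nonempty.to_type
  have hF : (0 : ℝ) < Fintype.card K := by exact_mod_cast Fintype.card_pos
  have ha : ∀ u, 0 < (p (w u)).toReal := fun u =>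
    ENNReal.toReal_pos (hp u) (p.apply_ne_top _)
  have hab : ∀ u, (p (w u)).toReal ≤ (p.map f (f (w u))).toReal := fun u =>
    ENNReal.toReal_mono (PMF.apply_ne_top _ _) (le_map_apply p f (w u))
  have hrr : ∀ t, 0 < (r (z t)).toReal := fun t => ENNReal.toReal_pos (hr t) (r.apply_ne_top _)
  have hlog : ∀ u, 0 ≤ Real.log ((p.map f (f (w u))).toReal / (p (w u)).toReal) := fun u =>
    Real.log_nonneg ((one_le_div (ha u)).2 (hab u))
  have key := prod_mul_sum_log_le (fun u => (p (w u)).toReal)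
    (fun u => (p.map f (f (w u))).toReal) (fun t => (r (z t)).toReal) (Fintype.card K) ha
    (fun u => (ha u).trans_le (hab u)) hrr hF
  have eA : (∏ u, p (w u)) = ENNReal.ofReal (∏ u, (p (w u)).toReal) := by
    rw [ENNReal.ofReal_prod_of_nonneg fun u _ => ENNReal.toReal_nonneg]
    exact Finset.prod_congr rfl fun u _ => (ENNReal.ofReal_toReal (p.apply_ne_top _)).symm
  have eB : (∏ u, p.map f (f (w u))) = ENNReal.ofReal (∏ u, (p.map f (f (w u))).toReal) := by
    rw [ENNReal.ofReal_prod_of_nonneg fun u _ => ENNReal.toReal_nonneg]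
    exact Finset.prod_congr rfl fun u _ => (ENNReal.ofReal_toReal (PMF.apply_ne_top _ _)).symm
  have eR : (∏ t, r (z t)) = ENNReal.ofReal (∏ t, (r (z t)).toReal) := by
    rw [ENNReal.ofReal_prod_of_nonneg fun u _ => ENNReal.toReal_nonneg]
    exact Finset.prod_congr rfl fun u _ => (ENNReal.ofReal_toReal (r.apply_ne_top _)).symm
  have eF : (∏ _t : Fin n, (Fintype.card K : ℝ≥0∞)⁻¹) =
      ENNReal.ofReal (∏ _t : Fin n, (Fintype.card K : ℝ)⁻¹) := by
    rw [ENNReal.ofReal_prod_of_nonneg fun u _ => (inv_pos.2 hF).le]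
    refine Finset.prod_congr rfl fun u _ => ?_
    rw [ENNReal.ofReal_inv_of_pos hF, ENNReal.ofReal_natCast]
  have eI : ∑ u, condInfo p f (w u) + 1 + n * ENNReal.ofReal (logDensityBound r) =
      ENNReal.ofReal (∑ u, Real.log ((p.map f (f (w u))).toReal / (p (w u)).toReal) + 1 +
        n * logDensityBound r) := by
    have hL := logDensityBound_nonneg r
    have hs := Finset.sum_nonneg fun u (_ : u ∈ Finset.univ) => hlog u
    rw [ENNReal.ofReal_add (by positivity) (by positivity), ENNReal.ofReal_add hs zero_le_one,
      ENNReal.ofReal_sum_of_nonneg fun u _ => hlog u, ENNReal.ofReal_mul (by positivity),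
      ENNReal.ofReal_natCast, ENNReal.ofReal_one]
    rfl
  have eS : ∑ t, shiftedLogDensity r (z t) =
      ENNReal.ofReal (∑ t, (Real.log (Fintype.card K * (r (z t)).toReal) + logDensityBound r)) := by
    rw [ENNReal.ofReal_sum_of_nonneg fun t _ => log_add_logDensityBound_nonneg r (z t)]
    rfl
  have hA : 0 ≤ ∏ u, (p (w u)).toReal := Finset.prod_nonneg fun u _ => ENNReal.toReal_nonneg
  have hB : 0 ≤ ∏ u, (p.map f (f (w u))).toReal :=
    Finset.prod_nonneg fun u _ => ENNReal.toReal_nonneg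
  have hR : 0 ≤ ∏ t, (r (z t)).toReal := Finset.prod_nonneg fun u _ => ENNReal.toReal_nonneg
  have hFp : 0 ≤ ∏ _t : Fin n, (Fintype.card K : ℝ)⁻¹ := Finset.prod_nonneg fun _ _ => by positivity
  have hS := Finset.sum_nonneg fun t (_ : t ∈ Finset.univ) =>
    log_add_logDensityBound_nonneg r (z t)
  rw [eA, eB, eR, eF, eI, eS, ← ENNReal.ofReal_mul hA, ← ENNReal.ofReal_mul (mul_nonneg hA hR),
    ← ENNReal.ofReal_mul hB, ← ENNReal.ofReal_mul (mul_nonneg hA hR),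
    ← ENNReal.ofReal_add (mul_nonneg hB hFp) (mul_nonneg (mul_nonneg hA hR) hS)]
  refine ENNReal.ofReal_le_ofReal ?_
  rw [Finset.sum_add_distrib, Finset.sum_const, Finset.card_univ, Fintype.card_fin, nsmul_eq_mul]
  linarith

/-- Sum the pointwise inequality over `S`; since `g ≥ 0`, its sum may be extended to all of `Ω`.
Substituting `P(S) = 1 - P(Sᶜ)` cancels `1 + c` up to the failure term. -/
theorem tsum_indicator_mul_le {Ω : Type*} (S : Set Ω) (P Q f g : Ω → ℝ≥0∞) (c D : ℝ≥0∞)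
    (hc : c ≠ ∞) (hP : ∑' ω, P ω = 1) (hQ : ∑' ω, S.indicator Q ω ≤ 1)
    (hpt : ∀ ω, P ω * (f ω + 1 + c) ≤ Q ω + P ω * g ω) (hg : ∑' ω, P ω * g ω ≤ D + c) :
    ∑' ω, S.indicator (fun ω => P ω * f ω) ω ≤
      D + (∑' ω, Sᶜ.indicator P ω) * (1 + c) := by
  have hsplit : ∑' ω, S.indicator P ω + ∑' ω, Sᶜ.indicator P ω = 1 := by
    rw [← ENNReal.tsum_add, ← hP]
    exact tsum_congr fun ω => Set.indicator_self_add_compl_apply S P ω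
  have hS : ∑' ω, S.indicator (fun ω => P ω * f ω) ω + (∑' ω, S.indicator P ω) * (1 + c) ≤
      1 + (D + c) := by
    rw [← ENNReal.tsum_mul_right, ← ENNReal.tsum_add]
    refine le_trans ?_ (add_le_add hQ hg)
    rw [← ENNReal.tsum_add]
    refine ENNReal.tsum_le_tsum fun ω => ?_
    by_cases h : ω ∈ S
    · simp only [Set.indicator_of_mem h]
      refine le_trans (le_of_eq ?_) (hpt ω)
      ring
    · simp [Set.indicator_of_notMem h]
  refine (ENNReal.add_le_add_iff_right (a := 1 + c) (by finiteness)).1 ?_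
  calc _ = ∑' ω, S.indicator (fun ω => P ω * f ω) ω + (∑' ω, S.indicator P ω) * (1 + c) +
        (∑' ω, Sᶜ.indicator P ω) * (1 + c) := by
        rw [add_assoc, ← add_mul, hsplit, one_mul]
    _ ≤ 1 + (D + c) + (∑' ω, Sᶜ.indicator P ω) * (1 + c) := by gcongr
    _ = _ := by ring

/-- Truncation: `f` is controlled only on `S`, so off `S` the bound `b` on `g` is used. -/
theorem tsum_mul_le_of_le {Ω : Type*} (S : Set Ω) (P f g : Ω → ℝ≥0∞) (b : ℝ≥0∞)
    (hgf : ∀ ω, g ω ≤ f ω) (hgb : ∀ ω, g ω ≤ b) :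
    ∑' ω, P ω * g ω ≤ ∑' ω, S.indicator (fun ω => P ω * f ω) ω +
      (∑' ω, Sᶜ.indicator P ω) * b := by
  rw [← ENNReal.tsum_mul_right, ← ENNReal.tsum_add]
  refine ENNReal.tsum_le_tsum fun ω => ?_
  by_cases h : ω ∈ S
  · simpa [h] using mul_le_mul_right (hgf ω) _
  · simpa [h] using mul_le_mul_right (hgb ω) _

theorem tsum_indicator_comp_le {Ω Ω' : Type*} (S : Set Ω) (φ : Ω → Ω') (hφ : Set.InjOn φ S)
    (G : Ω' → ℝ≥0∞) : ∑' ω, S.indicator (fun ω => G (φ ω)) ω ≤ ∑' x, G x := by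
  rw [← tsum_subtype]
  exact ENNReal.tsum_comp_le_tsum_of_injective (f := fun ω : S => φ ω) hφ.injective G

end changeOfMeasure

/-! ### Injectivity on the success event and the bounds for a single code -/

section code

variable {W : Fin 3 → Type*} {K : Type*} [Field K] {m n : ℕ}

/-- The source triplets and noise symbols for which every user decodes correctly. -/
def successSet (c : BlockCode W K m n) :
    Set ((Fin m → (i : Fin 3) → W i) × (Fin n → K) × (Fin 3 → Fin n → K)) :=
  {x | ¬ DecodingError c x.1 x.2.1 x.2.2}

theorem received_fst (c : BlockCode W K m n) (w : Fin m → (i : Fin 3) → W i)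
    (z₀ : Fin n → K) (z : Fin 3 → Fin n → K) (t : Fin n) :
    (received c w z₀ z t).1 = (∑ i, c.userEnc i t (fun u => w u i)
      (fun s => (received c w z₀ z ⟨s.val, s.isLt.trans t.isLt⟩).2 i)) + z₀ t := by
  rw [received]

theorem received_snd (c : BlockCode W K m n) (w : Fin m → (i : Fin 3) → W i)
    (z₀ : Fin n → K) (z : Fin 3 → Fin n → K) (t : Fin n) (i : Fin 3) :
    (received c w z₀ z t).2 i = c.relayEnc t
      (fun s => (received c w z₀ z ⟨s.val, s.isLt.trans t.isLt⟩).1) + z i t := by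
  rw [received]

theorem source_eq_of_success (c : BlockCode W K m n) (i : Fin 3)
    {w w' : Fin m → (i : Fin 3) → W i} {z₀ z₀' : Fin n → K} {z z' : Fin 3 → Fin n → K}
    (h : ¬ DecodingError c w z₀ z) (h' : ¬ DecodingError c w' z₀' z')
    (hw : ∀ u, w u i = w' u i)
    (hy : ∀ t, (received c w z₀ z t).2 i = (received c w' z₀' z' t).2 i) : w = w' := by
  simp only [DecodingError, not_exists, not_not] at h h'
  have e := h i
  rw [funext hy, funext hw, h' i] at e
  funext u j
  by_cases hj : j = i
  · subst hj
    exact hw u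
  · exact (congrFun (congrFun e ⟨j, hj⟩) u).symm

theorem injOn_relayOutput (c : BlockCode W K m n) (i : Fin 3) :
    Set.InjOn (fun x : (Fin m → (i : Fin 3) → W i) × (Fin n → K) × (Fin 3 → Fin n → K) =>
      ((fun u => x.1 u i : Fin m → W i), (fun t => (received c x.1 x.2.1 x.2.2 t).1 : Fin n → K),
        x.2.2)) (successSet c) := by
  rintro ⟨w, z₀, z⟩ hx ⟨w', z₀', z'⟩ hx' h
  simp only [Prod.mk.injEq] at h
  obtain ⟨hw, hy, rfl⟩ := h
  -- User outputs depend only on past relay outputs and user noises.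
  have hy2 : ∀ t j, (received c w z₀ z t).2 j = (received c w' z₀' z t).2 j := by
    intro t j
    rw [received_snd, received_snd]
    congr 2
    funext s
    exact congrFun hy _
  obtain rfl := source_eq_of_success c i hx hx' (congrFun hw) fun t => hy2 t i
  have : z₀ = z₀' := by
    funext t
    have ht := congrFun hy t
    simp only [received_fst, hy2] at ht
    exact add_left_cancel ht
  rw [this]

theorem injOn_userOutput (c : BlockCode W K m n) (i : Fin 3) :
    Set.InjOn (fun x : (Fin m → (i : Fin 3) → W i) × (Fin n → K) × (Fin 3 → Fin n → K) =>
      ((fun u => x.1 u i : Fin m → W i), x.2.1,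
        Function.update x.2.2 i fun t => (received c x.1 x.2.1 x.2.2 t).2 i)) (successSet c) := by
  rintro ⟨w, z₀, z⟩ hx ⟨w', z₀', z'⟩ hx' h
  simp only [Prod.mk.injEq] at h
  obtain ⟨hw, rfl, hz⟩ := h
  have hy : ∀ t, (received c w z₀ z t).2 i = (received c w' z₀ z' t).2 i := by
    intro t
    simpa using congrFun (congrFun hz i) t
  have hzj : ∀ j, j ≠ i → z j = z' j := by
    intro j hj
    simpa [hj] using congrFun hz j
  obtain rfl := source_eq_of_success c i hx hx' (congrFun hw) hy
  -- Induction on time: past outputs and `z₀` give the relay output, past relay outputs and `z j`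
  -- give the output of user `j ≠ i`, and user `i`'s output is given.
  have hrec : ∀ (k : ℕ) (hk : k < n), received c w z₀ z ⟨k, hk⟩ = received c w z₀ z' ⟨k, hk⟩ := by
    intro k
    induction k using Nat.strong_induction_on with
    | _ k ih =>
      intro hk
      refine Prod.ext ?_ (funext fun j => ?_)
      · rw [received_fst, received_fst]
        congr 1
        refine Finset.sum_congr rfl fun j _ => ?_
        congr 1
        funext s
        rw [ih s.val s.isLt]
      · by_cases hj : j = i
        · subst hj
          exact hy _
        · rw [received_snd, received_snd, hzj j hj]
          congr 2
          funext s
          rw [ih s.val s.isLt]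
  have : z = z' := by
    funext j t
    have ht := congrFun (congrArg Prod.snd (hrec t.val t.isLt)) j
    rw [received_snd, received_snd] at ht
    simp only [fun s : Fin t.val => hrec s.val (s.isLt.trans t.isLt)] at ht
    exact add_left_cancel ht
  rw [this]

theorem errorProb_eq [Fintype K] (p : PMF ((i : Fin 3) → W i)) (q₀ : PMF K) (q : Fin 3 → PMF K)
    (c : BlockCode W K m n) :
    errorProb p q₀ q c = ∑' x, (successSet c)ᶜ.indicator (weight p q₀ q) x := by
  classical
  rw [ENNReal.tsum_prod', errorProb]
  refine tsum_congr fun w => ?_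
  rw [ENNReal.tsum_prod', tsum_fintype]
  refine Finset.sum_congr rfl fun z₀ _ => ?_
  rw [tsum_fintype]
  refine Finset.sum_congr rfl fun z _ => ?_
  simp [Set.indicator_apply, successSet, weight]

/-- If the joint law factors through a noise with law `r`, and replacing that law by the uniform one
and the source law by its marginal gives mass at most one on the success event, then the truncated
conditional information is bounded by `log |K| - H(r)` per channel use. -/
theorem mul_tsum_min_condInfo_le [Fintype K] (p : PMF ((i : Fin 3) → W i)) (q₀ : PMF K)
    (q : Fin 3 → PMF K) (c : BlockCode W K m n) (i : Fin 3) (r : PMF K)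
    (ζ : (Fin m → (i : Fin 3) → W i) × (Fin n → K) × (Fin 3 → Fin n → K) → Fin n → K)
    (ρ : (Fin m → (i : Fin 3) → W i) × (Fin n → K) × (Fin 3 → Fin n → K) → ℝ≥0∞)
    (hr : entropy r ≤ Real.log (Fintype.card K))
    (hP : ∀ x, weight p q₀ q x = (∏ u, p (x.1 u)) * (∏ t, r (ζ x t)) * ρ x)
    (hQ : ∑' x, (successSet c).indicator (fun x => (∏ u, p.map (fun w => w i) (x.1 u i)) *
      (∏ _t : Fin n, (Fintype.card K : ℝ≥0∞)⁻¹) * ρ x) x ≤ 1)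
    (hζ : ∀ (f : K → ℝ≥0∞) (t : Fin n),
      ∑' x, weight p q₀ q x * f (ζ x t) = ∑' a, r a * f a) (b : ℝ≥0∞) :
    m * ∑' w, p w * min (condInfo p (fun w => w i) w) b ≤
      n * ENNReal.ofReal (Real.log (Fintype.card K) - entropy r) +
        errorProb p q₀ q c * (1 + n * ENNReal.ofReal (logDensityBound r) + m * b) := by
  have h1 := tsum_indicator_mul_le (successSet c) (weight p q₀ q) _
    (fun x => ∑ u, condInfo p (fun w => w i) (x.1 u))
    (fun x => ∑ t, shiftedLogDensity r (ζ x t))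
    (n * ENNReal.ofReal (logDensityBound r))
    (n * ENNReal.ofReal (Real.log (Fintype.card K) - entropy r)) (by finiteness)
    (tsum_weight p q₀ q) hQ ?_ ?_
  · have h2 := tsum_mul_le_of_le (successSet c) (weight p q₀ q)
      (fun x => ∑ u, condInfo p (fun w => w i) (x.1 u))
      (fun x => ∑ u, min (condInfo p (fun w => w i) (x.1 u)) b) (m * b)
      (fun x => Finset.sum_le_sum fun u _ => min_le_left _ _)
      (fun x => (Finset.sum_le_sum fun u _ => min_le_right _ _).trans (by simp))
    have h3 : ∑' x, weight (m := m) (n := n) p q₀ q x * ∑ u, min (condInfo p (fun w => w i) (x.1 u)) b =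
        m * ∑' w, p w * min (condInfo p (fun w => w i) w) b := by
      simp only [Finset.mul_sum]
      rw [Summable.tsum_finsetSum fun _ _ => ENNReal.summable]
      simp only [tsum_weight_mul_source p q₀ q fun w => min (condInfo p (fun w => w i) w) b]
      simp
    rw [← h3]
    refine h2.trans ((add_le_add_left h1 _).trans (le_of_eq ?_))
    rw [errorProb_eq]
    ring
  · intro x
    have h := mul_le_mul_left (prod_mul_condInfo_le p (fun w => w i) r x.1 (ζ x)) (ρ x)
    rw [hP]
    refine le_trans (le_of_eq ?_) (h.trans (le_of_eq ?_)) <;> ring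
  · simp only [Finset.mul_sum]
    rw [Summable.tsum_finsetSum fun _ _ => ENNReal.summable]
    simp only [hζ (shiftedLogDensity r), tsum_mul_shiftedLogDensity]
    rw [ENNReal.ofReal_add (sub_nonneg.2 hr) (logDensityBound_nonneg r)]
    simp

theorem mul_tsum_min_condInfo_le_relay [Fintype K] (p : PMF ((i : Fin 3) → W i)) (q₀ : PMF K)
    (q : Fin 3 → PMF K) (c : BlockCode W K m n) (i : Fin 3)
    (hr : entropy q₀ ≤ Real.log (Fintype.card K)) (b : ℝ≥0∞) :
    m * ∑' w, p w * min (condInfo p (fun w => w i) w) b ≤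
      n * ENNReal.ofReal (Real.log (Fintype.card K) - entropy q₀) +
        errorProb p q₀ q c * (1 + n * ENNReal.ofReal (logDensityBound q₀) + m * b) := by
  refine mul_tsum_min_condInfo_le p q₀ q c i q₀ (fun x => x.2.1)
    (fun x => ∏ i, ∏ t, q i (x.2.2 i t)) hr (fun x => rfl) ?_
    (fun f t => tsum_weight_mul_relayNoise p q₀ q f t) b
  -- `Q` is a genuine product law, with uniform relay noise, evaluated at the image of the
  -- injection, so its mass on the success event is at most one.
  refine le_of_eq_of_le ?_ ((tsum_indicator_comp_le _ _ (injOn_relayOutput c i)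
    (weight (p.map fun w => w i) (PMF.uniformOfFintype K) q)).trans (tsum_weight _ _ _).le)
  simp [weight]

theorem mul_tsum_min_condInfo_le_user [Fintype K] (p : PMF ((i : Fin 3) → W i)) (q₀ : PMF K)
    (q : Fin 3 → PMF K) (c : BlockCode W K m n) (i : Fin 3)
    (hr : entropy (q i) ≤ Real.log (Fintype.card K)) (b : ℝ≥0∞) :
    m * ∑' w, p w * min (condInfo p (fun w => w i) w) b ≤
      n * ENNReal.ofReal (Real.log (Fintype.card K) - entropy (q i)) +
        errorProb p q₀ q c * (1 + n * ENNReal.ofReal (logDensityBound (q i)) + m * b) := by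
  refine mul_tsum_min_condInfo_le p q₀ q c i (q i) (fun x => x.2.2 i)
    (fun x => (∏ t, q₀ (x.2.1 t)) * ∏ j ∈ Finset.univ.erase i, ∏ t, q j (x.2.2 j t)) hr
    (fun x => ?_) ?_ (fun f t => tsum_weight_mul_userNoise p q₀ q f i t) b
  · rw [weight, ← Finset.mul_prod_erase Finset.univ _ (Finset.mem_univ i)]
    ring
  · refine le_of_eq_of_le ?_ ((tsum_indicator_comp_le _ _ (injOn_userOutput c i)
      (weight (p.map fun w => w i) q₀ (Function.update q i (PMF.uniformOfFintype K)))).trans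
        (tsum_weight _ _ _).le)
    refine tsum_congr fun x => congrArg (fun g => (successSet c).indicator g x) (funext fun x => ?_)
    have he : ∀ y : Fin n → K, (∏ j ∈ Finset.univ.erase i, ∏ t,
        Function.update q i (PMF.uniformOfFintype K) j (Function.update x.2.2 i y j t)) =
          ∏ j ∈ Finset.univ.erase i, ∏ t, q j (x.2.2 j t) := fun y =>
      Finset.prod_congr rfl fun j hj => by
        rw [Function.update_of_ne (Finset.ne_of_mem_erase hj),
          Function.update_of_ne (Finset.ne_of_mem_erase hj)]
    simp only [weight]
    rw [← Finset.mul_prod_erase Finset.univ (fun j => ∏ t, Function.update q i _ j _)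
      (Finset.mem_univ i), he]
    simp only [Function.update_self, PMF.uniformOfFintype_apply]
    ring

end code

/-! ### Vanishing error probability and removal of the truncation -/

theorem tsum_mul_le_of_forall_min {Ω : Type*} (P f : Ω → ℝ≥0∞) (hf : ∀ ω, f ω ≠ ∞) (C : ℝ≥0∞)
    (h : ∀ b : ℝ≥0, ∑' ω, P ω * min (f ω) b ≤ C) : ∑' ω, P ω * f ω ≤ C := by
  rw [ENNReal.tsum_eq_iSup_sum]
  -- On a finite set, truncating at the sum of the values of `f` changes nothing.
  refine iSup_le fun s => le_trans ?_ (h (∑ ω ∈ s, (f ω).toNNReal))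
  refine le_trans (Finset.sum_le_sum fun ω hω => ?_) (ENNReal.sum_le_tsum s)
  have : f ω ≤ (∑ ω ∈ s, (f ω).toNNReal : ℝ≥0) := by
    rw [← ENNReal.coe_toNNReal (hf ω), ENNReal.coe_le_coe]
    exact Finset.single_le_sum (f := fun ω => (f ω).toNNReal) (fun _ _ => zero_le) hω
  rw [min_eq_left this]

theorem tsum_mul_condInfo_le {W : Fin 3 → Type*} {K : Type*} [Field K] [Fintype K]
    (p : PMF ((i : Fin 3) → W i)) (q₀ : PMF K) (q : Fin 3 → PMF K) (κ : ℝ≥0)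
    (hκ : Achievable p q₀ q κ) (i : Fin 3) (C L : ℝ≥0)
    (h : ∀ (m n : ℕ) (c : BlockCode W K m n) (b : ℝ≥0∞),
      m * ∑' w, p w * min (condInfo p (fun w => w i) w) b ≤
        n * (C : ℝ≥0∞) + errorProb p q₀ q c * (1 + n * (L : ℝ≥0∞) + m * b)) :
    ∑' w, p w * condInfo p (fun w => w i) w ≤ κ * C := by
  refine tsum_mul_le_of_forall_min _ _ (fun _ => ENNReal.ofReal_ne_top) _ fun b => ?_
  refine ENNReal.le_of_forall_pos_le_add fun ε hε _ => ?_
  -- As `n = m κ` and `1 ≤ m`, the error term is at most `m Pₑ (1 + κ L + b)`; this tolerance makes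
  -- it at most `m ε`.
  obtain ⟨m, n, hm, hmn, c, hc⟩ := hκ ((ε / (1 + κ * L + b) : ℝ≥0) : ℝ≥0∞)
    (ENNReal.coe_pos.2 (by positivity))
  have hm1 : (1 : ℝ≥0∞) ≤ m := by exact_mod_cast hm
  have hm0 : (m : ℝ≥0∞) ≠ 0 := by positivity
  have hn : (n : ℝ≥0∞) = m * κ := by
    have : (n : ℝ≥0) = m * κ := by
      rw [← hmn]
      field_simp
    exact_mod_cast congrArg ENNReal.ofNNReal this
  refine (ENNReal.mul_le_mul_iff_right hm0 (ENNReal.natCast_ne_top m)).1 ((h m n c b).trans ?_)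
  rw [hn]
  calc m * κ * (C : ℝ≥0∞) + errorProb p q₀ q c * (1 + m * κ * L + m * b)
      ≤ m * κ * (C : ℝ≥0∞) + ((ε / (1 + κ * L + b) : ℝ≥0) : ℝ≥0∞) *
        (m + m * κ * L + m * b) := by gcongr
    _ = m * (κ * C + ((ε / (1 + κ * L + b) : ℝ≥0) : ℝ≥0∞) * ((1 + κ * L + b : ℝ≥0) : ℝ≥0∞)) := by
        push_cast
        ring
    _ = m * (κ * C + ε) := by
        have h0 : 1 + κ * L + b ≠ 0 := by positivity
        rw [← ENNReal.coe_mul (ε / _), div_mul_cancel₀ _ h0]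

end MWRC

/-- For every three-user finite-field multi-way relay channel with correlated discrete memoryless
sources (joint law `p`) and non-uniform noise (laws `q₀` at the relay, `q i` at user `i`), the
minimum source-channel rate is at least `Φ`. -/
theorem lemma1 {W : Fin 3 → Type*} {K : Type*} [Field K] [Fintype K]
    (p : PMF ((i : Fin 3) → W i)) (q₀ : PMF K) (q : Fin 3 → PMF K)
    (hq₀ : MWRC.entropy q₀ < Real.log (Fintype.card K))
    (hq : ∀ i, MWRC.entropy (q i) < Real.log (Fintype.card K)) :
    MWRC.Phi p q₀ q ≤ MWRC.minRate p q₀ q := by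
  refine le_iInf₂ fun κ hκ => ?_
  refine iSup_le fun i => iSup_le fun j => iSup_le fun k => iSup_le fun h => ?_
  refine ENNReal.div_le_of_le_mul ?_
  -- Three distinct indices exhaust `Fin 3`, so `H(W_j, W_k | W_i)` is the mean of `condInfo` given
  -- `w i`.
  have hinj : Function.Injective fun w : (i : Fin 3) → W i => ((w j, w k), w i) := by
    intro w w' hw
    simp only [Prod.mk.injEq] at hw
    obtain ⟨⟨hj, hk⟩, hi⟩ := hw
    funext l
    have hl : l = i ∨ l = j ∨ l = k := by omega
    rcases hl with rfl | rfl | rfl <;> assumption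
  rw [MWRC.condEntropy_of_injective p _ _ hinj]
  -- Whichever noise attains the maximum, the bound for that noise applies.
  rcases max_choice (MWRC.entropy q₀) (MWRC.entropy (q i)) with h' | h' <;> rw [h']
  · exact MWRC.tsum_mul_condInfo_le p q₀ q κ hκ i _ (MWRC.logDensityBound q₀).toNNReal
      fun m n c b => MWRC.mul_tsum_min_condInfo_le_relay p q₀ q c i hq₀.le b
  · exact MWRC.tsum_mul_condInfo_le p q₀ q κ hκ i _ (MWRC.logDensityBound (q i)).toNNReal
      fun m n c b => MWRC.mul_tsum_min_condInfo_le_user p q₀ q c i (hq i).le b
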